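/- **Theorem 2.2.** Let $d\ge 1$, $N\ge 1$ and $K\in\mathbb T^d=(\mathbb R/2\pi\mathbb Z)^d$, and write $|y|_+=|y^{(1)}|+\dots+|y^{(d)}|$ for $y\in\mathbb Z^d$. Let $\hat\varepsilon_1,\dots,\hat\varepsilon_N:\mathbb Z^d\to\mathbb C$ satisfy $\hat\varepsilon_i(y)=\overline{\hat\varepsilon_i(-y)}$ for all $y$ and $\sum_{y\in\mathbb Z^d}|y|_+^{\delta}\,|\hat\varepsilon_i(y)|<\infty$ for some $\delta>0$, and let $\hat v_{ij}:\mathbb Z^d\to\mathbb R$ ($1\le i<j\le N$) tend to $0$ at infinity. On $\ell_2((\mathbb Z^d)^{N-1})$ consider the bounded self-adjoint operator $\hat H(K)=\hat H_0(K)-\sum_{1\le i<j\le N}\hat V_{ij}$. Here $$\hat H_0(K)=\sum_{j=1}^{N}\ \sum_{s\in\mathbb Z^d}\hat\varepsilon_j(s)\,T_j(s),$$ where, for $j<N$, $T_j(s)$ is the shift $x_j\mapsto x_j+s$ of the $j$-th variable, $(T_j(s)f)(x_1,\dots,x_{N-1})=f(x_1,\dots,x_j+s,\dots,x_{N-1})$,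 and $$(T_N(s)f)(x_1,\dots,x_{N-1})=e^{\mathrm i(s,K)}f(x_1+s,\dots,x_{N-1}+s),$$ and $\hat V_{ij}$ is multiplication by $\hat v_{ij}(x_i-x_j)$, with the convention $x_N=0$. A cluster decomposition is a partition $C$ of $\{1,\dots,N\}$ into nonempty sets (clusters). The corresponding cluster operator is $$\hat H^C(K)=\hat H(K)+\hat I^C,\qquad \hat I^C=\sum\hat V_{ij},$$ the last sum being over all pairs $i<j$ that lie in different clusters of $C$. $C$ is a refinement of $D$ if every cluster of $D$ is a union of clusters of $C$. The essential spectrum $\sigma_{\mathrm{ess}}(A)$ of a bounded self-adjoint operator $A$ is $\sigma(A)$ minus the set of isolated points of $\sigma(A)$ that are eigenvalues of finite multiplicity. If the cluster decomposition $C$ is a refinement of the cluster decomposition $D$ and $C\ne D$, then $$\sigma(\hat H^C(K))\subset\sigma_{\mathrm{ess}}(\hat H^D(K)).$$ -/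

import Mathlib

open scoped ENNReal

noncomputable section

namespace HVZ

/-- The lattice `ℤ^d`. -/
abbrev Site (d : ℕ) : Type := Fin d → ℤ

/-- The relative configuration space `(ℤ^d)^(N-1)` of `N = n + 1` particles: the positions
`x_1, …, x_{N-1}`, the last particle sitting at the origin. -/
abbrev Conf (n d : ℕ) : Type := Fin n → Site d

/-- The Hilbert space `ℓ²(X)`, for `X = (ℤ^d)^(N-1)`. -/
abbrev State (n d : ℕ) : Type := lp (fun _ : Conf n d => ℂ) 2

/-- `|y|₊ = |y^(1)| + ⋯ + |y^(d)|`. -/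
def oneNorm {d : ℕ} (y : Site d) : ℝ := ∑ l, |(y l : ℝ)|

/-- The character `e^{i(s,K)}` for `s ∈ ℤ^d` and `K` in the torus `(ℝ/2πℤ)^d`. -/
def character {d : ℕ} (K : Fin d → Real.Angle) (s : Site d) : ℂ :=
  ((∑ l, s l • K l).toCircle : ℂ)

theorem memℓp_translate {n d : ℕ} (a : Conf n d) (f : State n d) :
    Memℓp (fun x => f (x + a)) 2 := by
  have hp : (0 : ℝ) < (2 : ℝ≥0∞).toReal := by norm_num
  have h := (lp.memℓp f).summable hp
  exact (memℓp_gen_iff hp).2 ((Equiv.addRight a).summable_iff.2 h)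

/-- The translation `f ↦ f (· + a)` on `ℓ²((ℤ^d)^(N-1))`. -/
def translate {n d : ℕ} (a : Conf n d) : State n d →L[ℂ] State n d :=
  LinearMap.mkContinuous
    { toFun := fun f => ⟨fun x => f (x + a), memℓp_translate a f⟩
      map_add' := fun _ _ => rfl
      map_smul' := fun _ _ => rfl } 1 (fun f => by
      have hp : (0 : ℝ) < (2 : ℝ≥0∞).toReal := by norm_num
      refine le_of_eq ?_
      rw [one_mul, lp.norm_eq_tsum_rpow hp, lp.norm_eq_tsum_rpow hp]
      congr 1
      exact (Equiv.addRight a).tsum_eq (fun x => ‖f x‖ ^ (2 : ℝ≥0∞).toReal))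

/-- Multiplication by a bounded function `w` on `ℓ²((ℤ^d)^(N-1))`
(by convention `0` when `w` is unbounded). -/
def multiplication {n d : ℕ} (w : Conf n d → ℝ) : State n d →L[ℂ] State n d :=
  open Classical in
  if h : ∃ M : ℝ, 0 ≤ M ∧ ∀ x, |w x| ≤ M then
    lp.mapCLM 2 (fun x => (w x : ℂ) • ContinuousLinearMap.id ℂ ℂ) h.choose_spec.1
      (fun x => by simpa [norm_smul] using h.choose_spec.2 x)
  else 0

/-- The operators `T_j(s)` in relative coordinates: for `j < N` the translation of the `j`-th
coordinate by `s`; for `j = N` the simultaneous translation of all coordinates by `s`,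
times `e^{i(s,K)}`. -/
def particleShift {n d : ℕ} (K : Fin d → Real.Angle) (j : Fin (n + 1)) (s : Site d) :
    State n d →L[ℂ] State n d :=
  Fin.lastCases (motive := fun _ => State n d →L[ℂ] State n d)
    (character K s • translate (fun _ => s))
    (fun k => translate (Pi.single k s)) j

/-- The free Hamiltonian `H₀(K) = ∑_j ∑_s ε_j(s) T_j(s)`, the series in `s` being taken in
operator norm. -/
def freeHamiltonian {n d : ℕ} (ε : Fin (n + 1) → Site d → ℂ) (K : Fin d → Real.Angle) :
    State n d →L[ℂ] State n d :=
  ∑ j, ∑' s, ε j s • particleShift K j s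

/-- The position of the `i`-th particle, with `x_N = 0`. -/
def position {n d : ℕ} (x : Conf n d) (i : Fin (n + 1)) : Site d :=
  Fin.lastCases (motive := fun _ => Site d) 0 (fun k => x k) i

/-- The pair interaction `V_{ij}`: multiplication by `v_{ij}(x_i - x_j)`, with `x_N = 0`. -/
def pairInteraction {n d : ℕ} (v : Fin (n + 1) → Fin (n + 1) → Site d → ℝ)
    (i j : Fin (n + 1)) : State n d →L[ℂ] State n d :=
  multiplication fun x => v i j (position x i - position x j)

/-- The `N`-particle operator `H(K) = H₀(K) - ∑_{i<j} V_{ij}`. -/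
def hamiltonian {n d : ℕ} (ε : Fin (n + 1) → Site d → ℂ)
    (v : Fin (n + 1) → Fin (n + 1) → Site d → ℝ) (K : Fin d → Real.Angle) :
    State n d →L[ℂ] State n d :=
  freeHamiltonian ε K - ∑ i, ∑ j, if i < j then pairInteraction v i j else 0

/-- A cluster decomposition: a partition of the set of particles into nonempty clusters. -/
abbrev ClusterDecomposition (n : ℕ) : Type :=
  Finpartition (Finset.univ : Finset (Fin (n + 1)))

/-- `ij ∈ C`: the particles `i` and `j` lie in one cluster of `C`. -/
def SameCluster {n : ℕ} (C : ClusterDecomposition n) (i j : Fin (n + 1)) : Prop :=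
  ∃ P ∈ C.parts, i ∈ P ∧ j ∈ P

/-- `C` is a refinement of `D`: every cluster of `D` is a union of clusters of `C`. -/
def IsRefinement {n : ℕ} (C D : ClusterDecomposition n) : Prop :=
  ∀ P ∈ D.parts, ∃ S ⊆ C.parts, P = S.sup id

/-- `I^C`: the sum of the interactions between particles of different clusters of `C`. -/
def interClusterInteraction {n d : ℕ} (v : Fin (n + 1) → Fin (n + 1) → Site d → ℝ)
    (C : ClusterDecomposition n) : State n d →L[ℂ] State n d :=
  open Classical in
  ∑ i, ∑ j, if i < j ∧ ¬ SameCluster C i j then pairInteraction v i j else 0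

/-- The cluster operator `H^C(K) = H(K) + I^C`. -/
def clusterHamiltonian {n d : ℕ} (ε : Fin (n + 1) → Site d → ℂ)
    (v : Fin (n + 1) → Fin (n + 1) → Site d → ℝ) (K : Fin d → Real.Angle)
    (C : ClusterDecomposition n) : State n d →L[ℂ] State n d :=
  hamiltonian ε v K + interClusterInteraction v C

/-- The discrete spectrum of a bounded self-adjoint operator: the isolated points of the
spectrum that are eigenvalues of finite multiplicity. -/
def discreteSpectrum {E : Type*} [NormedAddCommGroup E] [InnerProductSpace ℂ E]
    (A : E →L[ℂ] E) : Set ℂ :=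
  {z | (∃ r > 0, spectrum ℂ A ∩ Metric.ball z r = {z}) ∧
    Module.End.HasEigenvalue (A : E →ₗ[ℂ] E) z ∧
    FiniteDimensional ℂ (Module.End.eigenspace (A : E →ₗ[ℂ] E) z)}

/-- The essential spectrum of a bounded self-adjoint operator: the part of the spectrum that
is not discrete. -/
def essentialSpectrum {E : Type*} [NormedAddCommGroup E] [InnerProductSpace ℂ E]
    (A : E →L[ℂ] E) : Set ℂ :=
  spectrum ℂ A \ discreteSpectrum A

end HVZ

end

/-! Move the clusters of `C` apart by vectors `b m`, with a different speed for each cluster. `H^C`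
retains only interactions inside clusters of `C`, which depend on unchanged differences `x_i - x_j`,
so it commutes with translation by `b m`. If `f` is an approximate eigenvector of `H^C` at `z`, so
is every translate of it. Moreover `H^D = H^C + I^D - I^C`, and both `I^D` and `I^C` consist of
interactions between different clusters of `C`; they tend to `0` on the translates since the
potentials vanish at infinity.

As `C ≠ D`, there are at least two clusters in `C`, so the `b m` are distinct and the translates
converge weakly to `0`. They form a Weyl sequence for `H^D` at `z`, which excludes both the
resolvent set and the discrete spectrum. -/

open Filter Topology

namespace HVZ

/-! ### Weyl's criterion for normal operators -/

section Weyl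

variable {E : Type*} [NormedAddCommGroup E] [InnerProductSpace ℂ E]

/-- A point of the spectrum of a normal operator is an approximate eigenvalue. -/
theorem exists_approx_eigenvector [CompleteSpace E] {A : E →L[ℂ] E} (hA : IsStarNormal A) {z : ℂ}
    (hz : z ∈ spectrum ℂ A) {η : ℝ} (hη : 0 < η) :
    ∃ f : E, ‖f‖ = 1 ∧ ‖A f - z • f‖ ≤ η := by
  by_contra! hcon
  have hlow : ∀ f : E, ‖f‖ ≤ η⁻¹ * ‖(A - algebraMap ℂ (E →L[ℂ] E) z) f‖ := by
    intro f
    rcases eq_or_ne f 0 with rfl | hf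
    · simp
    have hf' : 0 < ‖f‖ := norm_pos_iff.2 hf
    have h := (hcon ((‖f‖⁻¹ : ℂ) • f) (by simp [norm_smul, hf])).le
    have h2 : A ((‖f‖⁻¹ : ℂ) • f) - z • ((‖f‖⁻¹ : ℂ) • f) = (‖f‖⁻¹ : ℂ) • (A f - z • f) := by
      rw [map_smul, smul_sub, smul_comm]
    rw [h2, norm_smul, norm_inv, Complex.norm_real, norm_norm] at h
    have h3 : (A - algebraMap ℂ (E →L[ℂ] E) z) f = A f - z • f := by
      simp [Algebra.algebraMap_eq_smul_one]
    rw [h3]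
    rw [inv_mul_eq_div, le_div_iff₀ hf'] at h
    rw [inv_mul_eq_div, le_div_iff₀ hη]
    linarith
  have hnormal : IsStarNormal (A - algebraMap ℂ (E →L[ℂ] E) z) := by
    constructor
    have h1 := hA.star_comm_self
    rw [star_sub, ← algebraMap_star_comm]
    refine Commute.sub_left (Commute.sub_right h1 ?_) (Commute.sub_right ?_ ?_)
    · exact (Algebra.commutes z (star A)).symm
    · exact Algebra.commutes _ A
    · exact Algebra.commutes _ _
  have hanti := ContinuousLinearMap.antilipschitz_of_bound (K := ⟨η⁻¹, by positivity⟩)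
    (A - algebraMap ℂ (E →L[ℂ] E) z) hlow
  refine hz ?_
  rw [spectrum.mem_resolventSet_iff, IsUnit.sub_iff, ContinuousLinearMap.isUnit_iff_bijective,
    ContinuousLinearMap.bijective_iff_dense_range_and_antilipschitz]
  refine ⟨?_, _, hanti⟩
  -- By normality the orthogonal complement of the range is the kernel, which is trivial because of
  -- the lower bound.
  rw [Submodule.topologicalClosure_eq_top_iff, ContinuousLinearMap.IsStarNormal.orthogonal_range hnormal]
  exact LinearMap.ker_eq_bot.2 hanti.injective

/-- An operator of finite rank maps weakly null sequences to norm null sequences. -/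
theorem tendsto_apply_of_weakly_null [CompleteSpace E] (P : E →L[ℂ] E) (F : Submodule ℂ E)
    [FiniteDimensional ℂ F] (hPF : ∀ f, P f ∈ F) {f : ℕ → E}
    (hf : ∀ e : E, Tendsto (fun m => inner ℂ e (f m)) atTop (𝓝 0)) :
    Tendsto (fun m => P (f m)) atTop (𝓝 0) := by
  -- The adjoint turns each coordinate of `P x` into an inner product of `x` with a fixed vector.
  have hsum : ∀ x, P x = ∑ i, inner ℂ (P.adjoint (stdOrthonormalBasis ℂ F i : E)) x •
      (stdOrthonormalBasis ℂ F i : E) := by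
    intro x
    have h := congrArg (Subtype.val) ((stdOrthonormalBasis ℂ F).sum_repr' ⟨P x, hPF x⟩)
    simp only [AddSubmonoidClass.coe_finsetSum, Submodule.coe_smul, Submodule.coe_inner] at h
    simpa only [ContinuousLinearMap.adjoint_inner_left] using h.symm
  simp_rw [hsum]
  have := tendsto_finsetSum (Finset.univ) fun i _ =>
    (hf (P.adjoint (stdOrthonormalBasis ℂ F i : E))).smul_const (stdOrthonormalBasis ℂ F i : E)
  simpa using this

/-- A Riesz projection: an isolated point of the spectrum of a normal operator admits a bounded
inverse of `A - z` modulo an operator with range in the eigenspace. -/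
theorem exists_parametrix_of_isolated [CompleteSpace E] {A : E →L[ℂ] E} (hA : IsStarNormal A)
    {z : ℂ} {r : ℝ} (hr : 0 < r) (hz : spectrum ℂ A ∩ Metric.ball z r = {z}) :
    ∃ B P : E →L[ℂ] E, B * (A - algebraMap ℂ (E →L[ℂ] E) z) = 1 - P ∧
      ∀ f, P f ∈ Module.End.eigenspace (A : E →ₗ[ℂ] E) z := by
  classical
  -- Isolation of `z` makes continuity there automatic, so the functional calculus accepts functions
  -- that jump at `z`.
  have hcont : ∀ g : ℂ → ℂ, ContinuousOn g {z}ᶜ → ContinuousOn g (spectrum ℂ A) := by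
    intro g hg w hw
    rcases eq_or_ne w z with rfl | hwz
    · have hev : ∀ᶠ x in 𝓝[spectrum ℂ A] w, x = w := by
        filter_upwards [self_mem_nhdsWithin,
          mem_nhdsWithin_of_mem_nhds (Metric.ball_mem_nhds w hr)] with x hx hx'
        have : x ∈ spectrum ℂ A ∩ Metric.ball w r := ⟨hx, hx'⟩
        rwa [hz] at this
      refine ContinuousWithinAt.congr_of_eventuallyEq (f := fun _ => g w)
        continuousWithinAt_const ?_ rfl
      filter_upwards [hev] with x hx
      rw [hx]
    · exact (hg.continuousAt (isOpen_compl_singleton.mem_nhds hwz)).continuousWithinAt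
  let χ : ℂ → ℂ := fun w => if w = z then 1 else 0
  -- With `0⁻¹ = 0`, `h w * (w - z) = 1 - χ w` holds at `w = z` too.
  let h : ℂ → ℂ := fun w => (w - z)⁻¹
  have hχ : ContinuousOn χ (spectrum ℂ A) := hcont _ <|
    (continuousOn_const (c := (0 : ℂ))).congr fun w hw => if_neg hw
  have hh : ContinuousOn h (spectrum ℂ A) := hcont _ <|
    (continuousOn_id.sub continuousOn_const).inv₀ fun w hw => sub_ne_zero.2 hw
  have hid : cfc (fun w : ℂ => w - z) A = A - algebraMap ℂ (E →L[ℂ] E) z := by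
    rw [cfc_sub (fun w : ℂ => w) (fun _ => z) A, cfc_id' ℂ A, cfc_const z A]
  refine ⟨cfc h A, cfc χ A, ?_, fun f => ?_⟩
  · rw [← hid, ← cfc_mul h _ A hh, ← cfc_const_one ℂ A, ← cfc_sub (fun _ => 1) χ A continuousOn_const hχ]
    congr 1
    ext w
    by_cases hw : w = z
    · simp [h, χ, hw]
    · simp [h, χ, hw, inv_mul_cancel₀ (sub_ne_zero.2 hw)]
  · have h0 : (A - algebraMap ℂ (E →L[ℂ] E) z) * cfc χ A = 0 := by
      rw [← hid, ← cfc_mul _ χ A (by fun_prop) hχ, ← cfc_zero ℂ A]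
      congr 1
      ext w
      by_cases hw : w = z <;> simp [χ, hw]
    have h1 := congrArg (fun T : E →L[ℂ] E => T f) h0
    rw [Module.End.mem_eigenspace_iff]
    simpa [Algebra.algebraMap_eq_smul_one, sub_eq_zero] using h1

/-- Weyl's criterion: weakly null normalized sequences of arbitrarily good approximate
eigenvectors detect the essential spectrum. -/
theorem mem_essentialSpectrum_of_weyl [CompleteSpace E] {A : E →L[ℂ] E} (hA : IsStarNormal A)
    {z : ℂ} (hw : ∀ η > 0, ∃ f : ℕ → E, (∀ m, ‖f m‖ = 1) ∧
      (∀ᶠ m in atTop, ‖A (f m) - z • f m‖ ≤ η) ∧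
      ∀ e : E, Tendsto (fun m => inner ℂ e (f m)) atTop (𝓝 0)) :
    z ∈ essentialSpectrum A := by
  have key : ∀ B P : E →L[ℂ] E, B * (A - algebraMap ℂ (E →L[ℂ] E) z) = 1 - P →
      ∀ F : Submodule ℂ E, FiniteDimensional ℂ F → (∀ f, P f ∈ F) → False := by
    intro B P hBP F _ hPF
    -- This tolerance gives `‖B (A - z) f m‖ ≤ 1/2`; with `‖P (f m)‖ < 1/2` eventually, this
    -- contradicts `‖f m‖ = 1`.
    obtain ⟨f, hf1, hf2, hf3⟩ := hw (1 / (2 * (‖B‖ + 1))) (by positivity)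
    have hP := (tendsto_apply_of_weakly_null P F hPF hf3).norm
    rw [norm_zero] at hP
    obtain ⟨m, hm1, hm2⟩ := (hf2.and
      (hP.eventually_lt_const (show (0 : ℝ) < 1 / 2 by norm_num))).exists
    have h1 : B (A (f m) - z • f m) = f m - P (f m) := by
      simpa [Algebra.algebraMap_eq_smul_one] using
        congrArg (fun T : E →L[ℂ] E => T (f m)) hBP
    have h2 : ‖B (A (f m) - z • f m)‖ ≤ ‖B‖ * (1 / (2 * (‖B‖ + 1))) :=
      B.le_opNorm_of_le hm1
    have h3 : ‖B‖ * (1 / (2 * (‖B‖ + 1))) ≤ 1 / 2 := by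
      have := norm_nonneg B
      rw [mul_one_div, div_le_div_iff₀ (by positivity) (by norm_num)]
      linarith
    have h4 := norm_sub_norm_le (f m) (P (f m))
    rw [← h1, hf1] at h4
    linarith
  refine ⟨fun hz => ?_, ?_⟩
  · rw [spectrum.mem_resolventSet_iff, IsUnit.sub_iff] at hz
    obtain ⟨u, hu⟩ := hz
    exact key (↑u⁻¹) 0 (by rw [← hu]; simp) ⊥ inferInstance (by simp)
  · rintro ⟨⟨r, hr, hz⟩, -, hfin⟩
    obtain ⟨B, P, hBP, hP⟩ := exists_parametrix_of_isolated hA hr hz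
    exact key B P hBP _ hfin hP

end Weyl

/-! ### Translations and multiplication operators -/

variable {n d : ℕ}

@[simp]
theorem translate_apply (a : Conf n d) (f : State n d) (x : Conf n d) :
    translate a f x = f (x + a) := rfl

theorem norm_translate (a : Conf n d) (f : State n d) : ‖translate a f‖ = ‖f‖ := by
  have hp : (0 : ℝ) < (2 : ℝ≥0∞).toReal := by norm_num
  rw [lp.norm_eq_tsum_rpow hp, lp.norm_eq_tsum_rpow hp]
  congr 1
  exact (Equiv.addRight a).tsum_eq (fun x => ‖f x‖ ^ (2 : ℝ≥0∞).toReal)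

theorem norm_translate_le_one (a : Conf n d) : ‖(translate a : State n d →L[ℂ] State n d)‖ ≤ 1 :=
  ContinuousLinearMap.opNorm_le_bound _ zero_le_one fun f => by rw [norm_translate, one_mul]

theorem translate_commute (a b : Conf n d) :
    Commute (translate a : State n d →L[ℂ] State n d) (translate b) := by
  ext f x
  simp [add_right_comm]

theorem translate_single (a y : Conf n d) (c : ℂ) :
    translate a (lp.single 2 y c) = lp.single 2 (y - a) c := by
  ext x
  simp only [translate_apply, lp.single_apply, Pi.single_apply, eq_sub_iff_add_eq]

theorem star_translate (a : Conf n d) :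
    star (translate a : State n d →L[ℂ] State n d) = translate (-a) := by
  rw [ContinuousLinearMap.star_eq_adjoint, eq_comm, ContinuousLinearMap.eq_adjoint_iff]
  intro f g
  rw [lp.inner_eq_tsum, lp.inner_eq_tsum, ← (Equiv.addRight a).tsum_eq]
  simp

theorem multiplication_apply {w : Conf n d → ℝ} (hw : ∃ M : ℝ, 0 ≤ M ∧ ∀ x, |w x| ≤ M)
    (f : State n d) (x : Conf n d) : multiplication w f x = w x * f x := by
  rw [multiplication, dif_pos hw]
  simp [lp.mapCLM]

theorem isSelfAdjoint_multiplication (w : Conf n d → ℝ) : IsSelfAdjoint (multiplication w) := by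
  by_cases hw : ∃ M : ℝ, 0 ≤ M ∧ ∀ x, |w x| ≤ M
  · rw [ContinuousLinearMap.isSelfAdjoint_iff_isSymmetric]
    intro f g
    simp only [ContinuousLinearMap.coe_coe, lp.inner_eq_tsum, multiplication_apply hw]
    refine tsum_congr fun x => ?_
    simp
    ring
  · rw [multiplication, dif_neg hw]
    exact .zero _

theorem multiplication_single {w : Conf n d → ℝ} (hw : ∃ M : ℝ, 0 ≤ M ∧ ∀ x, |w x| ≤ M)
    (y : Conf n d) (c : ℂ) :
    multiplication w (lp.single 2 y c) = lp.single 2 y (w y * c) := by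
  ext x
  rw [multiplication_apply hw]
  rcases eq_or_ne x y with rfl | h
  · simp
  · simp [lp.single_apply, h]

theorem commute_multiplication_translate {w : Conf n d → ℝ} {a : Conf n d}
    (hwa : ∀ x, w (x + a) = w x) : Commute (multiplication w) (translate a) := by
  by_cases hw : ∃ M : ℝ, 0 ≤ M ∧ ∀ x, |w x| ≤ M
  · ext f x
    simp [multiplication_apply hw, hwa]
  · rw [multiplication, dif_neg hw]
    exact Commute.zero_left _

/-- A uniformly bounded sequence of operators tends to `0` strongly as soon as it does so on the
functions supported at one point. -/
theorem tendsto_zero_of_single {F : Type*} [NormedAddCommGroup F] [NormedSpace ℂ F]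
    {T : ℕ → State n d →L[ℂ] F} {M : ℝ} (hM : ∀ m, ‖T m‖ ≤ M)
    (hT : ∀ y c, Tendsto (fun m => T m (lp.single 2 y c)) atTop (𝓝 0)) (f : State n d) :
    Tendsto (fun m => T m f) atTop (𝓝 0) := by
  have hM0 : 0 ≤ M := (norm_nonneg _).trans (hM 0)
  have hfin : ∀ s : Finset (Conf n d),
      Tendsto (fun m => T m (∑ y ∈ s, lp.single 2 y (f y))) atTop (𝓝 0) := by
    intro s
    simp_rw [map_sum]
    simpa using tendsto_finsetSum s fun y _ => hT y (f y)
  rw [Metric.tendsto_atTop]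
  intro η hη
  have hη' : 0 < η / (2 * (M + 1)) := by positivity
  obtain ⟨s, hs⟩ := ((Metric.tendsto_nhds.1 (lp.hasSum_single (by norm_num) f)) _ hη').exists
  obtain ⟨m₀, hm₀⟩ := (Metric.tendsto_atTop.1 (hfin s)) (η / 2) (by positivity)
  refine ⟨m₀, fun m hm => ?_⟩
  have h1 := hm₀ m hm
  rw [dist_zero_right] at h1 ⊢
  rw [dist_comm, dist_eq_norm] at hs
  have h2 : ‖T m (f - ∑ y ∈ s, lp.single 2 y (f y))‖ ≤ M * (η / (2 * (M + 1))) :=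
    ((T m).le_of_opNorm_le (hM m) _).trans (by gcongr)
  have h3 : M * (η / (2 * (M + 1))) ≤ η / 2 := by
    rw [mul_div_assoc', div_le_div_iff₀ (by positivity) (by norm_num)]
    nlinarith
  have h4 : T m f = T m (f - ∑ y ∈ s, lp.single 2 y (f y)) +
      T m (∑ y ∈ s, lp.single 2 y (f y)) := by
    rw [← map_add, sub_add_cancel]
  rw [h4]
  exact (norm_add_le _ _).trans_lt (by linarith)

theorem tendsto_cofinite_zero (f : State n d) : Tendsto (fun x => f x) cofinite (𝓝 0) := by
  have hp : (0 : ℝ) < (2 : ℝ≥0∞).toReal := by norm_num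
  have h := ((lp.memℓp f).summable hp).tendsto_cofinite_zero
  rw [tendsto_zero_iff_norm_tendsto_zero]
  have h2 := h.sqrt
  simpa [Real.sqrt_sq] using h2

/-- Translations along a sequence of vectors escaping to infinity are weakly null. -/
theorem tendsto_inner_translate {b : ℕ → Conf n d} (hb : Function.Injective b)
    (e f : State n d) :
    Tendsto (fun m => inner ℂ e (translate (b m) f)) atTop (𝓝 0) := by
  refine tendsto_zero_of_single (T := fun m => (innerSL ℂ e).comp (translate (b m)))
    (M := ‖e‖) (fun m => ?_) (fun y c => ?_) f
  · refine (ContinuousLinearMap.opNorm_comp_le _ _).trans ?_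
    rw [innerSL_apply_norm]
    exact mul_le_of_le_one_right (norm_nonneg _) (norm_translate_le_one _)
  · simp only [ContinuousLinearMap.comp_apply, translate_single, innerSL_apply_apply,
      lp.inner_single_right]
    have hinj : Function.Injective fun m => y - b m := fun m m' h => hb (sub_right_injective h)
    have h := (tendsto_cofinite_zero e).comp (hinj.tendsto_cofinite)
    rw [Nat.cofinite_eq_atTop] at h
    simpa using ((continuous_star.tendsto _).comp h).const_mul c

theorem tendsto_multiplication_translate {w : Conf n d → ℝ}
    (hw : ∃ M : ℝ, 0 ≤ M ∧ ∀ x, |w x| ≤ M) {b : ℕ → Conf n d}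
    (hwb : ∀ y, Tendsto (fun m => w (y - b m)) atTop (𝓝 0)) (f : State n d) :
    Tendsto (fun m => multiplication w (translate (b m) f)) atTop (𝓝 0) := by
  refine tendsto_zero_of_single (T := fun m => (multiplication w).comp (translate (b m)))
    (M := ‖multiplication w‖) (fun m => ?_) (fun y c => ?_) f
  · refine (ContinuousLinearMap.opNorm_comp_le _ _).trans ?_
    exact mul_le_of_le_one_right (norm_nonneg _) (norm_translate_le_one _)
  · simp only [ContinuousLinearMap.comp_apply, translate_single, multiplication_single hw]
    rw [tendsto_zero_iff_norm_tendsto_zero]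
    have h := ((hwb y).norm).mul_const ‖c‖
    simpa [lp.norm_single] using h

/-! ### Self-adjointness and translation symmetry of the Hamiltonians -/

@[simp]
theorem particleShift_castSucc (K : Fin d → Real.Angle) (k : Fin n) (s : Site d) :
    particleShift K k.castSucc s = translate (Pi.single k s) := by
  simp [particleShift]

@[simp]
theorem particleShift_last (K : Fin d → Real.Angle) (s : Site d) :
    particleShift K (Fin.last n) s = character K s • translate (fun _ => s) := by
  simp [particleShift]

theorem star_character (K : Fin d → Real.Angle) (s : Site d) :
    star (character K s) = character K (-s) := by
  have h : (∑ l, (-s) l • K l) = -∑ l, s l • K l := by simp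
  rw [character, character, h, Real.Angle.toCircle_neg, Circle.coe_inv_eq_conj]
  rfl

theorem norm_character (K : Fin d → Real.Angle) (s : Site d) : ‖character K s‖ = 1 :=
  Circle.norm_coe _

theorem star_particleShift (K : Fin d → Real.Angle) (j : Fin (n + 1)) (s : Site d) :
    star (particleShift K j s) = particleShift K j (-s) := by
  induction j using Fin.lastCases with
  | last =>
    rw [particleShift_last, particleShift_last, star_smul, star_translate, star_character]
    rfl
  | cast k => rw [particleShift_castSucc, particleShift_castSucc, star_translate, Pi.single_neg]

theorem norm_particleShift_le_one (K : Fin d → Real.Angle) (j : Fin (n + 1)) (s : Site d) :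
    ‖particleShift K j s‖ ≤ 1 := by
  induction j using Fin.lastCases with
  | last =>
    rw [particleShift_last, norm_smul, norm_character, one_mul]
    exact norm_translate_le_one _
  | cast k =>
    rw [particleShift_castSucc]
    exact norm_translate_le_one _

theorem commute_particleShift_translate (K : Fin d → Real.Angle) (j : Fin (n + 1)) (s : Site d)
    (a : Conf n d) : Commute (particleShift K j s) (translate a) := by
  induction j using Fin.lastCases with
  | last =>
    rw [particleShift_last]
    exact (translate_commute _ _).smul_left _
  | cast k =>
    rw [particleShift_castSucc]
    exact translate_commute _ _

theorem one_le_oneNorm {y : Site d} (hy : y ≠ 0) : 1 ≤ oneNorm y := by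
  obtain ⟨l, hl⟩ := Function.ne_iff.1 hy
  have h : (1 : ℝ) ≤ |(y l : ℝ)| := by exact_mod_cast Int.one_le_abs hl
  exact h.trans (Finset.single_le_sum (f := fun l => |(y l : ℝ)|) (fun _ _ => abs_nonneg _)
    (Finset.mem_univ l))

/-- On the lattice the weight is at least `1` away from the origin, and one point does not affect
summability. -/
theorem summable_norm_of_weighted {e : Site d → ℂ} {δ : ℝ} (hδ : 0 < δ)
    (h : Summable fun y => oneNorm y ^ δ * ‖e y‖) : Summable fun y => ‖e y‖ := by
  refine h.of_norm_bounded_eventually ?_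
  filter_upwards [(Set.finite_singleton (0 : Site d)).compl_mem_cofinite] with y hy
  rw [norm_norm]
  exact le_mul_of_one_le_left (norm_nonneg _) (Real.one_le_rpow (one_le_oneNorm hy) hδ.le)

theorem isSelfAdjoint_freeHamiltonian {ε : Fin (n + 1) → Site d → ℂ}
    (hsymm : ∀ i y, ε i y = star (ε i (-y))) (K : Fin d → Real.Angle) :
    IsSelfAdjoint (freeHamiltonian ε K) := by
  refine isSelfAdjoint_sum _ fun j _ => ?_
  rw [IsSelfAdjoint, tsum_star, ← (Equiv.neg (Site d)).tsum_eq]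
  refine tsum_congr fun s => ?_
  rw [star_smul, star_particleShift, Equiv.neg_apply, neg_neg, ← hsymm]

/-- Each term is a scalar multiple of a translation; norm summability carries the commutation over
to the series. -/
theorem commute_freeHamiltonian_translate {ε : Fin (n + 1) → Site d → ℂ}
    (hε : ∀ i, Summable fun y => ‖ε i y‖) (K : Fin d → Real.Angle) (a : Conf n d) :
    Commute (freeHamiltonian ε K) (translate a) := by
  refine Commute.sum_left _ _ _ fun j _ => ?_
  have hs : Summable fun s => ε j s • (particleShift K j s : State n d →L[ℂ] State n d) := by
    refine (hε j).of_norm_bounded fun s => ?_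
    rw [norm_smul]
    exact mul_le_of_le_one_right (norm_nonneg _) (norm_particleShift_le_one _ _ _)
  rw [Commute, SemiconjBy, ← hs.tsum_mul_left, ← hs.tsum_mul_right]
  exact tsum_congr fun s => ((commute_particleShift_translate K j s a).smul_left _)

theorem isSelfAdjoint_clusterHamiltonian {ε : Fin (n + 1) → Site d → ℂ}
    (hsymm : ∀ i y, ε i y = star (ε i (-y))) (v : Fin (n + 1) → Fin (n + 1) → Site d → ℝ)
    (K : Fin d → Real.Angle) (C : ClusterDecomposition n) :
    IsSelfAdjoint (clusterHamiltonian ε v K C) := by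
  refine ((isSelfAdjoint_freeHamiltonian hsymm K).sub ?_).add ?_ <;>
  · refine isSelfAdjoint_sum _ fun i _ => isSelfAdjoint_sum _ fun j _ => ?_
    split_ifs
    · exact isSelfAdjoint_multiplication _
    · exact .zero _

theorem commute_clusterHamiltonian_translate {ε : Fin (n + 1) → Site d → ℂ}
    (hε : ∀ i, Summable fun y => ‖ε i y‖) (v : Fin (n + 1) → Fin (n + 1) → Site d → ℝ)
    (K : Fin d → Real.Angle) (C : ClusterDecomposition n) {a : Conf n d}
    (ha : ∀ i j, SameCluster C i j →
      ∀ x, position (x + a) i - position (x + a) j = position x i - position x j) :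
    Commute (clusterHamiltonian ε v K C) (translate a) := by
  classical
  -- Merging the two sums cancels every pair from different clusters.
  rw [clusterHamiltonian, hamiltonian, interClusterInteraction, sub_add, ← Finset.sum_sub_distrib]
  simp_rw [← Finset.sum_sub_distrib]
  refine (commute_freeHamiltonian_translate hε K a).sub_left <|
    Commute.sum_left _ _ _ fun i _ => Commute.sum_left _ _ _ fun j _ => ?_
  by_cases hij : i < j
  · by_cases hs : SameCluster C i j
    · simp only [hij, hs, not_true_eq_false, and_false, if_true, if_false, sub_zero]
      exact commute_multiplication_translate fun x => by rw [ha i j hs]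
    · simp [hij, hs]
  · simp [hij]

/-! ### Partitions and refinement -/

theorem sameCluster_iff {C : ClusterDecomposition n} {i j : Fin (n + 1)} :
    SameCluster C i j ↔ C.part i = C.part j := by
  rw [← C.mem_part_iff_part_eq_part (Finset.mem_univ i) (Finset.mem_univ j),
    C.mem_part_iff_exists, SameCluster]

theorem IsRefinement.sameCluster {C D : ClusterDecomposition n} (h : IsRefinement C D)
    {i j : Fin (n + 1)} (hij : SameCluster C i j) : SameCluster D i j := by
  obtain ⟨P, hP, hi, hj⟩ := hij
  obtain ⟨S, hS, hDS⟩ := h _ (D.part_mem.2 (Finset.mem_univ i))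
  have hiD : i ∈ D.part i := D.mem_part (Finset.mem_univ i)
  refine ⟨D.part i, D.part_mem.2 (Finset.mem_univ i), hiD, ?_⟩
  rw [hDS] at hiD ⊢
  obtain ⟨P', hP', hi'⟩ := Finset.mem_sup.1 hiD
  obtain rfl := C.eq_of_mem_parts hP (hS hP') hi hi'
  exact Finset.mem_sup.2 ⟨P, hP', hj⟩

theorem clusterDecomposition_ext {C D : ClusterDecomposition n}
    (h : ∀ i j, SameCluster C i j ↔ SameCluster D i j) : C = D := by
  have hpart : ∀ i, C.part i = D.part i := by
    intro i
    ext j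
    rw [C.mem_part_iff_exists, D.mem_part_iff_exists]
    exact h j i
  have hparts : ∀ C : ClusterDecomposition n, C.parts = Finset.univ.image C.part := by
    intro C
    ext P
    rw [Finset.mem_image]
    refine ⟨fun hP => ?_, ?_⟩
    · obtain ⟨i, hi⟩ := C.nonempty_of_mem_parts hP
      exact ⟨i, Finset.mem_univ i, C.part_eq_of_mem hP hi⟩
    · rintro ⟨i, -, rfl⟩
      exact C.part_mem.2 (Finset.mem_univ i)
  ext1
  rw [hparts C, hparts D, funext hpart]

/-- The one-cluster partition refines only itself. -/
theorem IsRefinement.exists_not_sameCluster {C D : ClusterDecomposition n} (h : IsRefinement C D)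
    (hne : C ≠ D) : ∃ i j, ¬ SameCluster C i j := by
  by_contra! hC
  exact hne (clusterDecomposition_ext fun i j => ⟨h.sameCluster, fun _ => hC i j⟩)

/-! ### Separating the clusters -/

/-- An integer label of the cluster of a particle. -/
def clusterLabel (C : ClusterDecomposition n) (i : Fin (n + 1)) : ℤ :=
  (Encodable.encode (C.part i) : ℤ)

theorem clusterLabel_eq_iff {C : ClusterDecomposition n} {i j : Fin (n + 1)} :
    clusterLabel C i = clusterLabel C j ↔ SameCluster C i j := by
  rw [sameCluster_iff, clusterLabel, clusterLabel, Nat.cast_inj, Encodable.encode_inj]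

/-- The displacement, relative to the last particle, that moves every cluster of `C` by a
distance proportional to its label. -/
def clusterDisplacement (d : ℕ) (C : ClusterDecomposition n) (m : ℕ) : Conf n d :=
  fun k _ => m * (clusterLabel C k.castSucc - clusterLabel C (Fin.last n))

theorem position_clusterDisplacement (C : ClusterDecomposition n) (m : ℕ) (i : Fin (n + 1)) :
    position (clusterDisplacement d C m) i =
      fun _ => m * (clusterLabel C i - clusterLabel C (Fin.last n)) := by
  induction i using Fin.lastCases with
  | last => ext; simp [position]
  | cast k => simp only [position, Fin.lastCases_castSucc]; rfl

theorem position_add (x y : Conf n d) (i : Fin (n + 1)) :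
    position (x + y) i = position x i + position y i := by
  induction i using Fin.lastCases <;> simp [position]

theorem position_sub (x y : Conf n d) (i : Fin (n + 1)) :
    position (x - y) i = position x i - position y i := by
  induction i using Fin.lastCases <;> simp [position]

theorem position_add_clusterDisplacement {C : ClusterDecomposition n} {i j : Fin (n + 1)}
    (hij : SameCluster C i j) (m : ℕ) (x : Conf n d) :
    position (x + clusterDisplacement d C m) i - position (x + clusterDisplacement d C m) j =
      position x i - position x j := by
  rw [position_add, position_add, position_clusterDisplacement, position_clusterDisplacement,
    clusterLabel_eq_iff.2 hij, add_sub_add_right_eq_sub]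

theorem injective_relative_displacement (hd : 1 ≤ d) {C : ClusterDecomposition n}
    {i j : Fin (n + 1)} (hij : ¬ SameCluster C i j) :
    Function.Injective fun m => position (clusterDisplacement d C m) i -
      position (clusterDisplacement d C m) j := by
  intro m m' h
  -- Every coordinate equals `m` times the nonzero label difference; `1 ≤ d` supplies one to
  -- compare.
  have h1 := congrFun h ⟨0, hd⟩
  simp only [position_clusterDisplacement, Pi.sub_apply] at h1
  have h2 : clusterLabel C i - clusterLabel C j ≠ 0 :=
    sub_ne_zero.2 fun h => hij (clusterLabel_eq_iff.1 h)
  have h3 : (m : ℤ) = m' := mul_right_cancel₀ h2 (by linear_combination h1)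
  exact_mod_cast h3

/-- Ensures that `multiplication` is the genuine operator, not its default value `0`. -/
theorem exists_bound_of_tendsto_cofinite {w : Site d → ℝ} (hw : Tendsto w cofinite (𝓝 0)) :
    ∃ M : ℝ, 0 ≤ M ∧ ∀ y, |w y| ≤ M := by
  have hfin : {y | ¬ |w y| < 1}.Finite := by
    have := hw.abs.eventually_lt_const (show |(0 : ℝ)| < 1 by simp)
    exact this
  obtain ⟨M, hM⟩ := (hfin.image fun y => |w y|).bddAbove
  refine ⟨max M 1, le_max_of_le_right zero_le_one, fun y => ?_⟩
  by_cases hy : |w y| < 1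
  · exact hy.le.trans (le_max_right _ _)
  · exact (hM ⟨y, hy, rfl⟩).trans (le_max_left _ _)

/-- Interactions between clusters that are moved apart vanish in the limit. -/
theorem tendsto_pairInteraction_translate (hd : 1 ≤ d)
    {v : Fin (n + 1) → Fin (n + 1) → Site d → ℝ} {C : ClusterDecomposition n}
    {i j : Fin (n + 1)} (hv : Tendsto (v i j) cofinite (𝓝 0)) (hij : ¬ SameCluster C i j)
    (f : State n d) :
    Tendsto (fun m => pairInteraction v i j (translate (clusterDisplacement d C m) f))
      atTop (𝓝 0) := by
  obtain ⟨M, hM, hb⟩ := exists_bound_of_tendsto_cofinite hv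
  refine tendsto_multiplication_translate ⟨M, hM, fun x => hb _⟩ (fun y => ?_) f
  have hinj : Function.Injective fun m => position (y - clusterDisplacement d C m) i -
      position (y - clusterDisplacement d C m) j := by
    intro m m' h
    simp only [position_sub] at h
    exact injective_relative_displacement hd hij (by linear_combination -h)
  have h := hv.comp hinj.tendsto_cofinite
  rwa [Nat.cofinite_eq_atTop] at h

theorem tendsto_interClusterInteraction_translate (hd : 1 ≤ d)
    {v : Fin (n + 1) → Fin (n + 1) → Site d → ℝ}
    (hv : ∀ i j, i < j → Tendsto (v i j) cofinite (𝓝 0)) {C D : ClusterDecomposition n}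
    (hCD : IsRefinement C D) (f : State n d) :
    Tendsto (fun m => interClusterInteraction v D (translate (clusterDisplacement d C m) f))
      atTop (𝓝 0) := by
  classical
  simp only [interClusterInteraction, sum_apply]
  have h : ∀ i j, Tendsto (fun m => (if i < j ∧ ¬ SameCluster D i j then pairInteraction v i j
      else 0) (translate (clusterDisplacement d C m) f)) atTop (𝓝 0) := by
    intro i j
    split_ifs with h
    -- Particles in different clusters of `D` are in different clusters of the finer `C`, hence are
    -- separated.
    · exact tendsto_pairInteraction_translate hd (hv i j h.1)
        (fun hC => h.2 (hCD.sameCluster hC)) f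
    · exact tendsto_const_nhds
  simpa only [Finset.sum_const_zero] using
    tendsto_finsetSum Finset.univ fun i _ => tendsto_finsetSum Finset.univ fun j _ => h i j

theorem IsRefinement.refl (C : ClusterDecomposition n) : IsRefinement C C :=
  fun P hP => ⟨{P}, Finset.singleton_subset_iff.2 hP, by simp⟩

end HVZ

/-! ### The inclusion of spectra -/

theorem theorem2p2 (n d : ℕ) (hd : 1 ≤ d)
    (ε : Fin (n + 1) → HVZ.Site d → ℂ)
    (hreg : ∀ i, ∃ δ : ℝ, 0 < δ ∧
      Summable fun y : HVZ.Site d => HVZ.oneNorm y ^ δ * ‖ε i y‖)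
    (hsymm : ∀ i y, ε i y = star (ε i (-y)))
    (v : Fin (n + 1) → Fin (n + 1) → HVZ.Site d → ℝ)
    (hv : ∀ i j, i < j → Filter.Tendsto (v i j) Filter.cofinite (nhds 0))
    (K : Fin d → Real.Angle)
    (C D : HVZ.ClusterDecomposition n)
    (hCD : HVZ.IsRefinement C D) (hne : C ≠ D) :
    spectrum ℂ (HVZ.clusterHamiltonian ε v K C) ⊆
      HVZ.essentialSpectrum (HVZ.clusterHamiltonian ε v K D) := by
  have hε : ∀ i, Summable fun y => ‖ε i y‖ := fun i =>
    let ⟨_, hδ, h⟩ := hreg i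
    HVZ.summable_norm_of_weighted hδ h
  obtain ⟨i, j, hij⟩ := hCD.exists_not_sameCluster hne
  let b := HVZ.clusterDisplacement (n := n) d C
  have hb : Function.Injective b := fun m m' h =>
    HVZ.injective_relative_displacement hd hij (by simp only [b] at h; simp only [h])
  intro z hz
  refine HVZ.mem_essentialSpectrum_of_weyl
    (HVZ.isSelfAdjoint_clusterHamiltonian hsymm v K D).isStarNormal fun η hη => ?_
  obtain ⟨f, hf, hfz⟩ := HVZ.exists_approx_eigenvector
    (HVZ.isSelfAdjoint_clusterHamiltonian hsymm v K C).isStarNormal hz (half_pos hη)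
  refine ⟨fun m => HVZ.translate (b m) f, fun m => by rw [HVZ.norm_translate, hf], ?_,
    fun e => HVZ.tendsto_inner_translate hb e f⟩
  -- The refinements of `D` and of `C` itself by `C` handle `I^D` and `I^C`.
  have hlim := ((HVZ.tendsto_interClusterInteraction_translate hd hv hCD f).sub
    (HVZ.tendsto_interClusterInteraction_translate hd hv (HVZ.IsRefinement.refl C) f)).norm
  rw [sub_zero, norm_zero] at hlim
  filter_upwards [hlim.eventually_lt_const (half_pos hη)] with m hm
  have hcomm : HVZ.clusterHamiltonian ε v K C (HVZ.translate (b m) f) =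
      HVZ.translate (b m) (HVZ.clusterHamiltonian ε v K C f) :=
    congrArg (fun T : HVZ.State n d →L[ℂ] HVZ.State n d => T f)
      (HVZ.commute_clusterHamiltonian_translate hε v K C fun i j h x =>
        HVZ.position_add_clusterDisplacement h m x).eq
  have hsplit : HVZ.clusterHamiltonian ε v K D (HVZ.translate (b m) f) -
      z • HVZ.translate (b m) f =
      HVZ.translate (b m) (HVZ.clusterHamiltonian ε v K C f - z • f) +
      (HVZ.interClusterInteraction v D (HVZ.translate (b m) f) -
        HVZ.interClusterInteraction v C (HVZ.translate (b m) f)) := by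
    rw [map_sub, map_smul, ← hcomm]
    simp only [HVZ.clusterHamiltonian, add_apply]
    abel
  rw [hsplit]
  refine (norm_add_le _ _).trans ?_
  rw [HVZ.norm_translate]
  linarith
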